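/- Let $\mathbb{F}_q$ be a finite field with $q$ elements, $A=\mathbb{F}_q[T]$, $F=\mathbb{F}_q(T)$, and let $K=F_\infty$ be the completion of $F$ at the place $\infty=1/T$, with ring of integers $\mathcal{O}$ and residue field $k$. Let $D$ be a quaternion division algebra over $F$ (a central division algebra of dimension $4$) that is split at $\infty$, that is, $D\otimes_F K\cong \mathbb{M}_2(K)$, and fix such an isomorphism of $K$-algebras. Let $\Lambda$ be a maximal $A$-order in $D$ and let $\Gamma=\Lambda^\times$ be its group of units, regarded as a subgroup of $\mathrm{GL}_2(K)$ through $\Lambda^\times\subset D^\times\subset (D\otimes_F K)^\times\cong\mathrm{GL}_2(K)$. Let $\mathcal{T}$ be the Bruhat–Tits tree of $\mathrm{PGL}_2(K)$. Its vertices are the classes $[L]$ of $\mathcal{O}$-lattices $L\subset K^2$ (finitely generated $\mathcal{O}$-submodules that span $K^2$ over $K$) modulo $L\sim xL$ for $x\in K^\times$. Two vertices are adjacent if they have representatives $L$ and $L'$ with $L'\subset L$ and $L/L'\cong k$, and the oriented edges are the ordered pairs of adjacent vertices. The group $\mathrm{GL}_2(K)$, and hence $\Gamma$, acts on $\mathcal{T}$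 by $g[L]=[gL]$. For a vertex $v$ and an oriented edge $y$ of $\mathcal{T}$, let $\Gamma_v$ and $\Gamma_y$ be their stabilizers in $\Gamma$. **Proposition.** For every vertex $v$ of $\mathcal{T}$, $\Gamma_v\cong\mathbb{F}_q^\times$ or $\Gamma_v\cong\mathbb{F}_{q^2}^\times$. For every oriented edge $y$ of $\mathcal{T}$, $\Gamma_y\cong\mathbb{F}_q^\times$. -/

import Mathlib

open scoped Pointwise TensorProduct Polynomial

/-! ### The Bruhat-Tits tree of `PGL(V)`

In this section `O` is the ring of integers of a discretely valued field `K`, and `V` is a `K`-vector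
space (of dimension two in the application). -/

namespace BruhatTits

variable (O K V : Type*) [CommRing O] [Field K] [Algebra O K]
  [AddCommGroup V] [Module O V] [Module K V] [IsScalarTower O K V]

/-- The lattices of `V`: the finitely generated `O`-submodules of `V` that generate the
`K`-vector space `V`. -/
abbrev Lattice : Type _ := {L : Submodule O V // Submodule.IsLattice K L}

/-- Two lattices `L` and `L'` are equivalent if `L' = x L` for some `x ∈ Kˣ`. -/
def homothety : Setoid (Lattice O K V) where
  r L L' := ∃ x : Kˣ, (L' : Submodule O V) = x • (L : Submodule O V)
  iseqv :=
    { refl := fun L => ⟨1, (one_smul _ _).symm⟩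
      symm := by
        rintro L L' ⟨x, hx⟩
        exact ⟨x⁻¹, by rw [hx, inv_smul_smul]⟩
      trans := by
        rintro L L' L'' ⟨x, hx⟩ ⟨y, hy⟩
        exact ⟨y * x, by rw [hy, hx, mul_smul]⟩ }

/-- The vertices of the Bruhat-Tits tree: the equivalence classes `[L]` of lattices of `V`. -/
def Vertex : Type _ := Quotient (homothety O K V)

variable {O K V}

/-- The vertex `[L]` given by a lattice `L`. -/
def Vertex.mk (L : Lattice O K V) : Vertex O K V := Quotient.mk (homothety O K V) L

/-- The vertices `v` and `w` have representatives `L` and `L'` with `L' ⊆ L` such that `L / L'` is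
isomorphic, as an `O`-module, to the residue field of `O`. -/
def Vertex.IsNeighbor [IsLocalRing O] (v w : Vertex O K V) : Prop :=
  ∃ L L' : Lattice O K V, Vertex.mk L = v ∧ Vertex.mk L' = w ∧
    (L' : Submodule O V) ≤ (L : Submodule O V) ∧
    Nonempty (((L : Submodule O V) ⧸ (L' : Submodule O V).submoduleOf (L : Submodule O V)) ≃ₗ[O]
      IsLocalRing.ResidueField O)

variable (O K V) in
/-- The Bruhat-Tits tree: two vertices are adjacent if they have representatives `L`, `L'`, one
contained in the other, with quotient isomorphic to the residue field. The relation `IsNeighbor` is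
symmetric and irreflexive when `V` has dimension two, so that symmetrizing it and removing
the diagonal, as `SimpleGraph.fromRel` does, changes nothing. -/
def tree [IsLocalRing O] : SimpleGraph (Vertex O K V) := SimpleGraph.fromRel Vertex.IsNeighbor

variable (O K V) in
/-- The oriented edges of the Bruhat-Tits tree: the ordered pairs of adjacent vertices (origin,
terminus); `SimpleGraph.Dart.symm` is the inversion of edges. -/
abbrev Edge [IsLocalRing O] : Type _ := (tree O K V).Dart

/-- The image `g(L)` of an `O`-submodule `L` of `V` under `g ∈ GL(V)`. -/
def image (g : LinearMap.GeneralLinearGroup K V) (L : Submodule O V) : Submodule O V :=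
  L.map ((g : V →ₗ[K] V).restrictScalars O)

theorem mem_image (g : LinearMap.GeneralLinearGroup K V) (L : Submodule O V) (v : V) :
    v ∈ image g L ↔ ∃ w ∈ L, (g : V →ₗ[K] V) w = v := Iff.rfl

theorem injective_coe (g : LinearMap.GeneralLinearGroup K V) :
    Function.Injective (g : V →ₗ[K] V) := MulAction.injective g

theorem isLattice_image (g : LinearMap.GeneralLinearGroup K V) (L : Submodule O V)
    (hL : Submodule.IsLattice K L) : Submodule.IsLattice K (image g L) where
  fg := hL.fg.map _
  span_eq_top := by
    have h : ((image g L : Submodule O V) : Set V) = (g : V →ₗ[K] V) '' (L : Set V) := rfl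
    rw [h, ← Submodule.map_span, hL.span_eq_top, Submodule.map_top, LinearMap.range_eq_top]
    intro v
    exact ⟨g⁻¹ • v, smul_inv_smul g v⟩

/-- `GL(V)` acts on the lattices of `V` by `g • L = g(L)`. -/
instance instMulActionLattice :
    MulAction (LinearMap.GeneralLinearGroup K V) (Lattice O K V) where
  smul g L := ⟨image g L, isLattice_image g L.1 L.2⟩
  one_smul L := Subtype.ext (Submodule.map_id (L : Submodule O V))
  mul_smul g h L := Subtype.ext (Submodule.map_comp ((h : V →ₗ[K] V).restrictScalars O)
    ((g : V →ₗ[K] V).restrictScalars O) (L : Submodule O V))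

theorem coe_smul_lattice (g : LinearMap.GeneralLinearGroup K V) (L : Lattice O K V) :
    ((g • L : Lattice O K V) : Submodule O V) = image g L := rfl

theorem smul_homothety (g : LinearMap.GeneralLinearGroup K V) (L L' : Lattice O K V)
    (h : homothety O K V L L') : homothety O K V (g • L) (g • L') := by
  obtain ⟨x, hx⟩ := h
  refine ⟨x, ?_⟩
  rw [coe_smul_lattice, coe_smul_lattice, hx]
  ext v
  simp only [mem_image]
  constructor
  · rintro ⟨_, ⟨w, hw, rfl⟩, rfl⟩
    exact ⟨(g : V →ₗ[K] V) w, ⟨w, hw, rfl⟩, ((g : V →ₗ[K] V).map_smul (x : K) w).symm⟩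
  · rintro ⟨_, ⟨w, hw, rfl⟩, rfl⟩
    exact ⟨x • w, ⟨w, hw, rfl⟩, (g : V →ₗ[K] V).map_smul (x : K) w⟩

/-- `GL(V)` acts on the vertices of the tree by `g • [L] = [g(L)]`. -/
instance instMulActionVertex :
    MulAction (LinearMap.GeneralLinearGroup K V) (Vertex O K V) where
  smul g := Quotient.map (g • ·) (smul_homothety g)
  one_smul := by
    rintro ⟨L⟩
    exact congrArg Vertex.mk (one_smul _ L)
  mul_smul g h := by
    rintro ⟨L⟩
    exact congrArg Vertex.mk (mul_smul g h L)

theorem smul_mk (g : LinearMap.GeneralLinearGroup K V) (L : Lattice O K V) :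
    g • Vertex.mk L = Vertex.mk (g • L) := rfl

theorem smul_isNeighbor [IsLocalRing O] (g : LinearMap.GeneralLinearGroup K V) {v w : Vertex O K V}
    (h : v.IsNeighbor w) : (g • v).IsNeighbor (g • w) := by
  obtain ⟨L, L', rfl, rfl, hle, ⟨e⟩⟩ := h
  let f : (L : Submodule O V) ≃ₗ[O] ((g • L : Lattice O K V) : Submodule O V) :=
    Submodule.equivMapOfInjective ((g : V →ₗ[K] V).restrictScalars O) (injective_coe g) L
  have hf : ((L' : Submodule O V).submoduleOf (L : Submodule O V)).map f.toLinearMap =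
      ((g • L' : Lattice O K V) : Submodule O V).submoduleOf
        ((g • L : Lattice O K V) : Submodule O V) := by
    ext ⟨_, w, hw, rfl⟩
    simp only [Submodule.mem_map, Submodule.submoduleOf, Submodule.mem_comap]
    constructor
    · rintro ⟨y, hy, hyw⟩
      exact ⟨y, hy, congrArg Subtype.val hyw⟩
    · rintro ⟨y, hy, hyw⟩
      exact ⟨⟨y, hle hy⟩, hy, Subtype.ext hyw⟩
  exact ⟨g • L, g • L', rfl, rfl, (Submodule.map_mono hle : image g L'.1 ≤ image g L.1),
    ⟨(Submodule.Quotient.equiv _ _ f hf).symm.trans e⟩⟩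

theorem smul_adj [IsLocalRing O] (g : LinearMap.GeneralLinearGroup K V) {v w : Vertex O K V}
    (h : (tree O K V).Adj v w) : (tree O K V).Adj (g • v) (g • w) := by
  rw [tree, SimpleGraph.fromRel_adj] at h ⊢
  exact ⟨fun hh => h.1 (MulAction.injective g hh),
    h.2.imp (smul_isNeighbor g) (smul_isNeighbor g)⟩

/-- `GL(V)` acts on the oriented edges of the tree, through its action on their extremities. -/
instance instMulActionEdge [IsLocalRing O] :
    MulAction (LinearMap.GeneralLinearGroup K V) (Edge O K V) where
  smul g y := ⟨(g • y.fst, g • y.snd), smul_adj g y.adj⟩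
  one_smul y := SimpleGraph.Dart.ext _ _
    (Prod.ext (one_smul _ y.fst) (one_smul _ y.snd))
  mul_smul g h y := SimpleGraph.Dart.ext _ _
    (Prod.ext (mul_smul g h y.fst) (mul_smul g h y.snd))

end BruhatTits

/-! ### Orders and their unit groups -/

namespace QuaternionUnits

/-- An `A`-order in an algebra `D` over the field of fractions `F` of `A`: a subring of `D` that
contains `A`, is finitely generated as an `A`-module, and spans `D` over `F`. -/
def IsOrder (A F D : Type*) [CommRing A] [Field F] [Ring D] [Algebra A F] [Algebra F D]
    [Algebra A D] [IsScalarTower A F D] (Λ : Subalgebra A D) : Prop :=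
  Submodule.IsLattice F (Subalgebra.toSubmodule Λ)

/-- An `A`-order that is not properly contained in another `A`-order. -/
def IsMaximalOrder (A F D : Type*) [CommRing A] [Field F] [Ring D] [Algebra A F] [Algebra F D]
    [Algebra A D] [IsScalarTower A F D] (Λ : Subalgebra A D) : Prop :=
  Maximal (IsOrder A F D) Λ

/-- The embedding `Λˣ → Dˣ → (K ⊗ D)ˣ ≅ GL₂(K) = GL(K²)` that is given by an isomorphism
`φ : K ⊗ D ≅ M₂(K)`. -/
noncomputable def embedding {A F K D : Type*} [CommRing A] [Field F] [Field K] [Ring D]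
    [Algebra A D] [Algebra F K] [Algebra F D]
    (φ : (K ⊗[F] D) ≃ₐ[K] Matrix (Fin 2) (Fin 2) K) (Λ : Subalgebra A D) :
    (Λ)ˣ →* LinearMap.GeneralLinearGroup K (Fin 2 → K) :=
  (Matrix.GeneralLinearGroup.toLin : _ ≃* _).toMonoidHom.comp
    (Units.map (((φ : (K ⊗[F] D) →* Matrix (Fin 2) (Fin 2) K).comp
      (Algebra.TensorProduct.includeRight : D →ₐ[F] K ⊗[F] D).toMonoidHom).comp
        (Λ.val : Λ →* D)))

end QuaternionUnits

/-! ### The place at infinity of `𝔽(T)` -/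

/-- The ring of integers of the completion of `𝔽(T)` at the place `∞ = 1/T`. -/
noncomputable abbrev IntegersAtInfty (𝔽 : Type*) [Field 𝔽] [DecidableEq (RatFunc 𝔽)] :
    ValuationSubring (RatFunc.CompletionAtInfty 𝔽) :=
  (Valued.v : Valuation (RatFunc.CompletionAtInfty 𝔽)
    (WithZero (Multiplicative ℤ))).valuationSubring

/-!
Let `L` be a lattice of `K²`, and let `S` be the ring of the elements of `Λ` that preserve `L`
(`latticeOrder`). The minimal polynomial over `F` of an element of `S` has coefficients in
`A = 𝔽[T]`, since `Λ` is an order. It is also the minimal polynomial over `K` of an endomorphism that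
preserves `L`, so its coefficients lie in `O`. As `A ∩ O = 𝔽`, the ring `S` is algebraic over `𝔽`
(`isIntegral_of_mem_latticeOrder`). As `D` has no zero divisors and `𝔽` is finite, `S` is then a
division ring, and the stabilizer of the vertex `[L]` is its group of units
(`mem_stabilizer_mk_iff`).

The division ring `S` acts on the reduction of `L` modulo the maximal ideal of `O`. The residue field
of `O` is `𝔽`, so this is a group of order `q ^ 2`, hence a vector space over `S`, so that `S` is finite
and its order is `q` or `q ^ 2` (`Subalgebra.natCard_eq_pow_of_action`). By Wedderburn's theorem `S` is
a field. For an edge, given by `L' ⊆ L`, the elements of `Λ` that preserve both lattices act in the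
same way on `L / L'`, which has order `q`, so that they form a field of order `q`.
-/

/-! ### The place at infinity -/

namespace PlaceAtInfty
open RatFunc WithZero

variable (𝔽 : Type*) [Field 𝔽] [DecidableEq (RatFunc 𝔽)]

theorem valued_algebraMap (r : RatFunc 𝔽) :
    Valued.v (algebraMap (RatFunc 𝔽) (CompletionAtInfty 𝔽) r) = inftyValuationDef 𝔽 r :=
  letI := inftyValued 𝔽
  (Valued.valuedCompletion_apply r)

instance : (Valued.v : Valuation (CompletionAtInfty 𝔽) ℤᵐ⁰).IsNontrivial :=
  ⟨algebraMap _ _ RatFunc.X, by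
    rw [valued_algebraMap, ← inftyValuation_apply]; simp⟩

variable {𝔽}

/-- The intersection of `𝔽[T]` with the ring of integers at infinity: a
polynomial without a pole at infinity is constant. -/
theorem eq_C_of_algebraMap_mem {p : 𝔽[X]}
    (hp : algebraMap (RatFunc 𝔽) (CompletionAtInfty 𝔽) (algebraMap 𝔽[X] (RatFunc 𝔽) p) ∈
      IntegersAtInfty 𝔽) : ∃ c, Polynomial.C c = p := by
  rw [Valuation.mem_valuationSubring_iff, valued_algebraMap] at hp
  by_cases h : p = 0
  · exact ⟨0, by simp [h]⟩
  rw [inftyValuation.polynomial 𝔽 h, ← exp_zero, exp_le_exp] at hp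
  exact ⟨p.coeff 0, (Polynomial.eq_C_of_natDegree_eq_zero (by omega)).symm⟩

theorem algebraMap_C_mem (c : 𝔽) :
    algebraMap (RatFunc 𝔽) (CompletionAtInfty 𝔽) (RatFunc.C c) ∈ IntegersAtInfty 𝔽 := by
  rw [Valuation.mem_valuationSubring_iff, valued_algebraMap, ← inftyValuation_apply]
  by_cases hc : c = 0
  · simp [hc]
  · rw [inftyValuation.C 𝔽 hc]

variable (𝔽) in
/-- The inclusion of the constants into the ring of integers at infinity. -/
noncomputable def const : 𝔽 →+* IntegersAtInfty 𝔽 :=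
  ((algebraMap (RatFunc 𝔽) (CompletionAtInfty 𝔽)).comp RatFunc.C).codRestrict
    (IntegersAtInfty 𝔽) algebraMap_C_mem

/-- An element of `𝔽(T)` without pole at infinity has a value at infinity. -/
theorem exists_sub_C_lt_one {r : RatFunc 𝔽} (hr : inftyValuationDef 𝔽 r ≤ 1) :
    ∃ c : 𝔽, inftyValuationDef 𝔽 (r - RatFunc.C c) < 1 := by
  have hq0 : r.denom ≠ 0 := r.denom_ne_zero
  have hq0' : algebraMap 𝔽[X] (RatFunc 𝔽) r.denom ≠ 0 := by simpa using hq0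
  have hdeg : r.num.natDegree ≤ r.denom.natDegree := by
    by_cases h : r = 0
    · simp [h]
    rw [inftyValuation_of_nonzero 𝔽 h, ← exp_zero, exp_le_exp, RatFunc.intDegree] at hr
    omega
  -- The denominator is monic, so this constant is the quotient of the coefficients of degree
  -- `deg r.denom`.
  let c := r.num.coeff r.denom.natDegree
  let p := r.num - Polynomial.C c * r.denom
  have hp : r - RatFunc.C c =
      algebraMap 𝔽[X] (RatFunc 𝔽) p / algebraMap 𝔽[X] (RatFunc 𝔽) r.denom := by
    rw [eq_div_iff hq0', sub_mul]
    simp only [p, map_sub, map_mul, RatFunc.algebraMap_C]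
    congr 1
    nth_rw 1 [← r.num_div_denom]
    exact div_mul_cancel₀ _ hq0'
  have hpdeg : p.degree < r.denom.degree := by
    rw [Polynomial.degree_eq_natDegree hq0, Polynomial.degree_lt_iff_coeff_zero]
    intro m hm
    rcases hm.eq_or_lt with rfl | hm
    · simp [p, c, (RatFunc.monic_denom r).coeff_natDegree]
    · simp [p, Polynomial.coeff_eq_zero_of_natDegree_lt hm,
        Polynomial.coeff_eq_zero_of_natDegree_lt (hdeg.trans_lt hm)]
  refine ⟨c, ?_⟩
  by_cases h0 : p = 0
  · simp [hp, h0, inftyValuationDef]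
  rw [hp, ← inftyValuation_apply, map_div₀, inftyValuation_apply, inftyValuation_apply,
    inftyValuation.polynomial 𝔽 h0, inftyValuation.polynomial 𝔽 hq0, ← exp_sub, ← exp_zero,
    exp_lt_exp, sub_neg]
  exact_mod_cast Polynomial.natDegree_lt_natDegree h0 hpdeg

/-- By density of `𝔽(T)` in its completion, every residue class at infinity contains a constant. -/
theorem residue_const_surjective :
    Function.Surjective ((IsLocalRing.residue (IntegersAtInfty 𝔽)).comp (const 𝔽)) := by
  intro y
  obtain ⟨x, rfl⟩ := IsLocalRing.residue_surjective y
  let := inftyValued 𝔽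
  have hd : DenseRange (algebraMap (RatFunc 𝔽) (CompletionAtInfty 𝔽)) :=
    UniformSpace.Completion.denseRange_coe
  have hnhds : {z : CompletionAtInfty 𝔽 | Valued.v (z - (x : CompletionAtInfty 𝔽)) < 1} ∈
      nhds (x : CompletionAtInfty 𝔽) := by
    refine Valued.mem_nhds.2 ⟨1, fun z hz ↦ ?_⟩
    rwa [Set.mem_ofPred_eq, Units.val_one, Valuation.restrict_lt_one_iff] at hz
  obtain ⟨_, hz, r, rfl⟩ := mem_closure_iff_nhds.1 (hd (x : CompletionAtInfty 𝔽)) _ hnhds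
  have hz : Valued.v (algebraMap (RatFunc 𝔽) (CompletionAtInfty 𝔽) r - x) < 1 := hz
  have hr : inftyValuationDef 𝔽 r ≤ 1 := by
    rw [← valued_algebraMap]
    have := Valuation.map_add_le Valued.v hz.le ((Valuation.mem_valuationSubring_iff _ _).1 x.2)
    rwa [sub_add_cancel] at this
  obtain ⟨c, hc⟩ := exists_sub_C_lt_one hr
  refine ⟨c, ?_⟩
  rw [← valued_algebraMap, map_sub, Valuation.map_sub_swap] at hc
  rw [RingHom.comp_apply, ← sub_eq_zero, ← map_sub, IsLocalRing.residue_eq_zero_iff,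
    Valuation.mem_maximalIdeal_iff]
  have := Valuation.map_add_lt Valued.v hc hz
  rwa [sub_add_sub_cancel] at this

theorem natCard_residueField :
    Nat.card (IsLocalRing.ResidueField (IntegersAtInfty 𝔽)) = Nat.card 𝔽 :=
  (Nat.card_congr (Equiv.ofBijective _ ⟨RingHom.injective _, residue_const_surjective⟩)).symm

end PlaceAtInfty

/-! ### Minimal polynomials, base change and integrality -/

/-- The minimal polynomial of an element of an algebra does not change under extension of the base
field, since linearly independent powers stay linearly independent. -/
theorem minpoly_one_tmul {F K D : Type*} [Field F] [Field K] [Ring D] [Algebra F K] [Algebra F D]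
    {a : D} (ha : IsIntegral F a) :
    minpoly K ((1 : K) ⊗ₜ[F] a) = (minpoly F a).map (algebraMap F K) := by
  symm
  have hpow (i : ℕ) : ((1 : K) ⊗ₜ[F] a) ^ i = 1 ⊗ₜ[F] (a ^ i) := by
    rw [Algebra.TensorProduct.tmul_pow, one_pow]
  refine minpoly.unique' _ _ ((minpoly.monic ha).map _) ?_ fun q hq ↦ ?_
  · have := congrArg (Algebra.TensorProduct.includeRight : D →ₐ[F] K ⊗[F] D) (minpoly.aeval F a)
    rw [Polynomial.aeval_map_algebraMap]
    rwa [← Polynomial.aeval_algHom_apply, map_zero] at this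
  · by_contra! h
    apply h.1
    have hli := Module.Flat.linearIndependent_one_tmul (S := K)
      (linearIndependent_pow (K := F) a)
    rw [Polynomial.degree_map, Polynomial.degree_eq_natDegree (minpoly.ne_zero ha)] at hq
    have h2 := h.2
    rw [Polynomial.aeval_eq_sum_range' ((Polynomial.natDegree_lt_iff_degree_lt h.1).2 hq),
      ← Fin.sum_univ_eq_sum_range fun i ↦ q.coeff i • ((1 : K) ⊗ₜ[F] a) ^ i] at h2
    simp only [hpow] at h2
    have hc := Fintype.linearIndependent_iff.1 hli _ h2
    ext i
    by_cases hi : i < (minpoly F a).natDegree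
    · exact hc ⟨i, hi⟩
    · exact Polynomial.coeff_eq_zero_of_degree_lt (hq.trans_le (by exact_mod_cast not_lt.1 hi))

/-- Gauss's lemma: the minimal polynomial over the field of fractions of an element that is integral
over an integrally closed ring `R` has coefficients in `R`. -/
theorem exists_map_eq_minpoly_of_aeval_eq_zero {R K B : Type*} [CommRing R] [IsIntegrallyClosed R]
    [Field K] [Algebra R K] [IsFractionRing R K] [Ring B] [Algebra K B] {x : B} {p : R[X]}
    (hp : p.Monic) (hx : Polynomial.aeval x (p.map (algebraMap R K)) = 0) :
    ∃ g : R[X], g.map (algebraMap R K) = minpoly K x := by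
  obtain ⟨g, hg⟩ := IsIntegrallyClosed.eq_map_mul_C_of_dvd K hp (minpoly.dvd K x hx)
  refine ⟨g, ?_⟩
  rwa [(minpoly.monic ⟨_, hp.map (algebraMap R K), hx⟩).leadingCoeff, Polynomial.C_1, mul_one] at hg

/-! ### Endomorphisms that preserve a lattice -/

section Lattice
variable {O K V : Type*} [CommRing O] [Field K] [Algebra O K]
  [AddCommGroup V] [Module O V] [Module K V] [IsScalarTower O K V]

/-- The ring of the endomorphisms of a vector space that preserve a submodule over a subring
of the field. -/
def Submodule.endRing (L : Submodule O V) : Subring (Module.End K V) where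
  carrier := {f | ∀ w ∈ L, f w ∈ L}
  mul_mem' hf hg w hw := hf _ (hg w hw)
  one_mem' _ hw := hw
  add_mem' hf hg w hw := L.add_mem (hf w hw) (hg w hw)
  zero_mem' _ _ := L.zero_mem
  neg_mem' hf w hw := L.neg_mem (hf w hw)

/-- The action of the endomorphisms of a vector space that preserve a submodule on that
submodule. -/
def Submodule.endRingRestrict (L : Submodule O V) :
    L.endRing (K := K) →+* Module.End O L where
  toFun f := ((f : Module.End K V).restrictScalars O).restrict f.2
  map_one' := rfl
  map_mul' _ _ := rfl
  map_zero' := rfl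
  map_add' _ _ := rfl

/-- An endomorphism that preserves a lattice is integral over the base ring of the lattice. Integrality
is stated over `K`, so that no `O`-algebra structure on the endomorphism ring of `V` is involved. -/
theorem Submodule.exists_monic_aeval_eq_zero (L : Submodule O V) [L.IsLattice K]
    {f : Module.End K V} (hf : f ∈ L.endRing) :
    ∃ p : O[X], p.Monic ∧ Polynomial.aeval f (p.map (algebraMap O K)) = 0 := by
  have := Submodule.IsLattice.finite K L
  obtain ⟨p, hp, h0⟩ := Algebra.IsIntegral.isIntegral (R := O)
    (L.endRingRestrict ⟨f, hf⟩)
  refine ⟨p, hp, ?_⟩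
  have key (q : O[X]) (w : L) : Polynomial.aeval f (q.map (algebraMap O K)) (w : V) =
      (Polynomial.aeval (L.endRingRestrict ⟨f, hf⟩) q w : L) := by
    induction q using Polynomial.induction_on' generalizing w with
    | add p q hp hq =>
      rw [Polynomial.map_add, map_add, map_add, LinearMap.add_apply, LinearMap.add_apply, hp, hq]
      rfl
    | monomial n a =>
      have hpow : ((f ^ n) (w : V)) = ((L.endRingRestrict ⟨f, hf⟩ ^ n) w : L) := by
        induction n generalizing w with
        | zero => rfl
        | succ n ih => rw [pow_succ, pow_succ, Module.End.mul_apply, Module.End.mul_apply, ← ih]; rfl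
      simp [Polynomial.aeval_monomial, hpow]
  have hL : Set.EqOn (Polynomial.aeval f (p.map (algebraMap O K))) (0 : Module.End K V) L := by
    intro w hw
    rw [key p ⟨w, hw⟩, Polynomial.aeval_def, h0]
    rfl
  exact LinearMap.ext_on Submodule.IsLattice.span_eq_top hL

end Lattice

/-! ### Algebraic subalgebras of division rings over finite fields -/

section Algebraic
variable {𝔽 D : Type*} [Field 𝔽] [Finite 𝔽] [DivisionRing D] [Algebra 𝔽 D]

theorem IsIntegral.exists_pow_eq_one {a : D} (ha : IsIntegral 𝔽 a) (h0 : a ≠ 0) :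
    ∃ n ≠ 0, a ^ n = 1 := by
  have : Module.Finite 𝔽 (Algebra.adjoin 𝔽 {a}) := .of_fg ha.fg_adjoin_singleton
  have : Finite (Algebra.adjoin 𝔽 {a}) := Module.finite_of_finite 𝔽
  obtain ⟨m, n, hmn, h⟩ := Finite.exists_ne_map_eq_of_infinite fun n : ℕ ↦
    (⟨a, Algebra.self_mem_adjoin_singleton 𝔽 a⟩ : Algebra.adjoin 𝔽 {a}) ^ n
  replace h : a ^ m = a ^ n := congrArg Subtype.val h
  wlog hlt : m < n generalizing m n
  · exact this n m hmn.symm h.symm (by omega)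
  refine ⟨n - m, by omega, ?_⟩
  rw [pow_sub₀ a h0 hlt.le, h, mul_inv_cancel₀ (pow_ne_zero n h0)]

/-- Nonzero elements that are algebraic over a finite field have finite order, so that their inverses
are among their powers. -/
theorem Subalgebra.inv_mem_of_isIntegral {S : Subalgebra 𝔽 D} (hS : ∀ a ∈ S, IsIntegral 𝔽 a)
    {a : D} (ha : a ∈ S) : a⁻¹ ∈ S := by
  by_cases h0 : a = 0
  · simp [h0]
  obtain ⟨n, hn, h⟩ := (hS a ha).exists_pow_eq_one h0
  have : a⁻¹ = a ^ (n - 1) := by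
    refine inv_eq_of_mul_eq_one_right ?_
    rw [← pow_succ', Nat.sub_add_cancel (Nat.pos_of_ne_zero hn), h]
  exact this ▸ S.pow_mem ha _

/-- A subalgebra of a division ring that is algebraic over a finite field `𝔽` and acts on a
nonzero finite group of order `q ^ j`, where `q` is the order of `𝔽`, is finite of order `q ^ e`
for a divisor `e` of `j`: the group is a vector space over it. -/
theorem Subalgebra.natCard_eq_pow_of_action {S : Subalgebra 𝔽 D}
    (hS : ∀ a ∈ S, IsIntegral 𝔽 a) {R W : Type*} [Semiring R] [AddCommGroup W] [Module R W]
    (θ : S →+* Module.End R W) {j : ℕ} (hj : j ≠ 0) (hW : Nat.card W = Nat.card 𝔽 ^ j) :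
    Finite S ∧ ∃ e, e ∣ j ∧ Nat.card S = Nat.card 𝔽 ^ e := by
  have h1 : 1 < Nat.card 𝔽 := Finite.one_lt_card
  have : Finite W := Nat.finite_of_card_ne_zero (by rw [hW]; positivity)
  have : Nontrivial W := Finite.one_lt_card_iff_nontrivial.1 (hW ▸ Nat.one_lt_pow hj h1)
  obtain ⟨w, hw⟩ := exists_ne (0 : W)
  have : Finite S := by
    refine Finite.of_injective (fun s ↦ θ s w) ((injective_iff_map_eq_zero
      ((LinearMap.toAddMonoidHom'.flip w).comp θ.toAddMonoidHom)).2 fun s hs ↦ ?_)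
    by_contra h0
    let t : S := ⟨(s : D)⁻¹, S.inv_mem_of_isIntegral hS s.2⟩
    have hts : t * s = 1 := Subtype.ext (inv_mul_cancel₀ fun h ↦ h0 (Subtype.ext h))
    apply hw
    have hs : θ s w = 0 := hs
    calc w = θ (t * s) w := by rw [hts, map_one]; rfl
      _ = 0 := by rw [map_mul, Module.End.mul_apply, hs, map_zero]
  refine ⟨this, Module.finrank 𝔽 S, ?_, Module.natCard_eq_pow_finrank⟩
  -- A finite domain is a field, by Wedderburn's theorem, and `W` is a vector space over it.
  let : Field S := (Finite.isDomain_to_isField S).toField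
  let : Module S W := Module.compHom W θ
  refine ⟨Module.finrank S W, Nat.pow_right_injective h1 ?_⟩
  change _ ^ _ = _ ^ _
  rw [← hW, pow_mul, ← Module.natCard_eq_pow_finrank]
  exact Module.natCard_eq_pow_finrank

theorem nonempty_units_mulEquiv_of_natCard_eq {S E : Type*} [Ring S] [IsDomain S] [Finite S]
    [Field E] (h : Nat.card S = Nat.card E) : Nonempty (Sˣ ≃* Eˣ) := by
  have : Finite E := Nat.finite_of_card_ne_zero (h ▸ Nat.card_pos.ne')
  let : Field S := (Finite.isDomain_to_isField S).toField
  have := Fintype.ofFinite S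
  have := Fintype.ofFinite E
  exact ⟨Units.mapEquiv (FiniteField.ringEquivOfCardEq
    (by rwa [← Nat.card_eq_fintype_card, ← Nat.card_eq_fintype_card])).toMulEquiv⟩

end Algebraic

/-- A group `H` of units of a subring `Λ` of a division ring is the unit group of `S ≤ Λ` if its
elements are the units of `Λ` that lie in `S`, provided `S` is closed under inverses. -/
theorem nonempty_mulEquiv_units {A 𝔽 D : Type*} [CommRing A] [CommRing 𝔽] [DivisionRing D]
    [Algebra A D] [Algebra 𝔽 D] {Λ : Subalgebra A D} {S : Subalgebra 𝔽 D}
    (hSΛ : ∀ a ∈ S, a ∈ Λ) (hinv : ∀ a ∈ S, a⁻¹ ∈ S) {H : Subgroup Λˣ}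
    (hH : ∀ γ : Λˣ, γ ∈ H ↔ ((γ : Λ) : D) ∈ S) : Nonempty (H ≃* Sˣ) := by
  let i : S →+* Λ := S.toSubring.subtype.codRestrict Λ fun a ↦ hSΛ a a.2
  have hi : Function.Injective i := fun a b h ↦ Subtype.ext (congrArg (fun x : Λ ↦ (x : D)) h)
  have hr : (Units.map (i : S →* Λ)).range = H := by
    ext γ
    rw [hH]
    constructor
    · rintro ⟨u, rfl⟩
      exact (u : S).2
    · intro h
      have h0 : ((γ : Λ) : D) ≠ 0 := fun h0 ↦ γ.ne_zero (Subtype.ext h0)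
      exact ⟨⟨⟨_, h⟩, ⟨_, hinv _ h⟩, Subtype.ext (mul_inv_cancel₀ h0),
        Subtype.ext (inv_mul_cancel₀ h0)⟩, Units.ext (Subtype.ext rfl)⟩
  exact ⟨((MonoidHom.ofInjective (Units.map_injective hi)).trans
    (MulEquiv.subgroupCongr hr)).symm⟩

/-! ### Units of quaternion orders and lattices at infinity -/

namespace QuaternionUnits
open BruhatTits RatFunc PlaceAtInfty

section
variable {F K D : Type*} [Field F] [Field K] [Ring D] [Algebra F K] [Algebra F D]
  (φ : (K ⊗[F] D) ≃ₐ[K] Matrix (Fin 2) (Fin 2) K)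

/-- The action of `D` on `K²` given by an isomorphism `φ : K ⊗ D ≅ M₂(K)`. -/
noncomputable def toEnd : D →+* Module.End K (Fin 2 → K) :=
  (Matrix.toLinAlgEquiv' : Matrix (Fin 2) (Fin 2) K ≃ₐ[K] _).toRingEquiv.toRingHom.comp
    ((φ : (K ⊗[F] D) →+* Matrix (Fin 2) (Fin 2) K).comp
      (Algebra.TensorProduct.includeRight : D →ₐ[F] K ⊗[F] D).toRingHom)

theorem toEnd_apply (a : D) : toEnd φ a = (φ.trans Matrix.toLinAlgEquiv') (1 ⊗ₜ a) := rfl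

theorem toEnd_algebraMap_apply (r : F) (w : Fin 2 → K) :
    toEnd φ (algebraMap F D r) w = algebraMap F K r • w := by
  have : (1 : K) ⊗ₜ[F] (algebraMap F D r) = algebraMap K (K ⊗[F] D) (algebraMap F K r) := by
    rw [Algebra.TensorProduct.algebraMap_apply, Algebra.algebraMap_eq_smul_one r,
      TensorProduct.tmul_smul, TensorProduct.smul_tmul', Algebra.algebraMap_eq_smul_one r]
    rfl
  rw [toEnd_apply, this, AlgEquiv.commutes]
  rfl

theorem minpoly_toEnd {a : D} (ha : IsIntegral F a) :
    minpoly K (toEnd φ a) = (minpoly F a).map (algebraMap F K) := by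
  rw [toEnd_apply, minpoly.algEquiv_eq, minpoly_one_tmul ha]

end

theorem algebraMap_const {𝔽 D : Type*} [Field 𝔽] [Ring D] [Algebra (RatFunc 𝔽) D]
    [Algebra 𝔽[X] D] [IsScalarTower 𝔽[X] (RatFunc 𝔽) D] [Algebra 𝔽 D] [IsScalarTower 𝔽 𝔽[X] D]
    (c : 𝔽) :
    algebraMap 𝔽 D c = algebraMap (RatFunc 𝔽) D (RatFunc.C c) := by
  rw [IsScalarTower.algebraMap_apply 𝔽 𝔽[X] D, Polynomial.algebraMap_apply,
    IsScalarTower.algebraMap_apply 𝔽[X] (RatFunc 𝔽) D, ← RatFunc.algebraMap_C]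
  rfl

section
variable {𝔽 : Type*} [Field 𝔽] [DecidableEq (RatFunc 𝔽)]
  {D : Type*} [DivisionRing D] [Algebra (RatFunc 𝔽) D]
  [Algebra 𝔽[X] D] [IsScalarTower 𝔽[X] (RatFunc 𝔽) D]
  (φ : (CompletionAtInfty 𝔽 ⊗[RatFunc 𝔽] D) ≃ₐ[CompletionAtInfty 𝔽]
      Matrix (Fin 2) (Fin 2) (CompletionAtInfty 𝔽))
  (Λ : Subalgebra 𝔽[X] D) [Algebra 𝔽 D] [IsScalarTower 𝔽 𝔽[X] D]

/-- The elements of `Λ` that preserve a lattice of `K²`: the global sections of the order given by `Λ`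
away from infinity and by the endomorphism ring of the lattice at infinity. It is an algebra
over the constants only, as multiplication by `T` does not preserve the lattice. -/
noncomputable def latticeOrder
    (L : Lattice (IntegersAtInfty 𝔽) (CompletionAtInfty 𝔽) (Fin 2 → CompletionAtInfty 𝔽)) :
    Subalgebra 𝔽 D where
  toSubsemiring := Λ.toSubsemiring ⊓ (L.1.endRing.comap (toEnd φ)).toSubsemiring
  algebraMap_mem' c := by
    refine ⟨?_, fun w hw ↦ ?_⟩
    · rw [IsScalarTower.algebraMap_apply 𝔽 𝔽[X] D]
      exact Λ.algebraMap_mem _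
    · rw [algebraMap_const, toEnd_algebraMap_apply]
      exact L.1.smul_mem (const 𝔽 c) hw

variable {φ Λ} {L L' : Lattice (IntegersAtInfty 𝔽) (CompletionAtInfty 𝔽)
  (Fin 2 → CompletionAtInfty 𝔽)}

/-- An element of `Λ` that preserves a lattice at infinity is algebraic over the constants: the
coefficients of its minimal polynomial are polynomials in `T`, as `Λ` is an order, and have no pole
at infinity, as the lattice is preserved. -/
theorem isIntegral_of_mem_latticeOrder (hΛ : IsOrder 𝔽[X] (RatFunc 𝔽) D Λ) {a : D}
    (ha : a ∈ latticeOrder φ Λ L) : IsIntegral 𝔽 a := by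
  obtain ⟨haΛ, haL⟩ := ha
  have hA : IsIntegral 𝔽[X] a := .of_mem_of_fg Λ hΛ.fg a haΛ
  have hF : IsIntegral (RatFunc 𝔽) a := hA.tower_top
  have := L.2
  obtain ⟨p, hp, hpa⟩ := L.1.exists_monic_aeval_eq_zero haL
  obtain ⟨h, hh⟩ := exists_map_eq_minpoly_of_aeval_eq_zero hp hpa
  obtain ⟨p', hp', hpa'⟩ := hA
  obtain ⟨g, hg⟩ := exists_map_eq_minpoly_of_aeval_eq_zero (K := RatFunc 𝔽) (x := a) hp' (by
    rwa [Polynomial.aeval_map_algebraMap])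
  rw [minpoly_toEnd φ hF, ← hg] at hh
  have hc (i : ℕ) : ∃ c, Polynomial.C c = g.coeff i := by
    refine eq_C_of_algebraMap_mem ?_
    have := congrArg (Polynomial.coeff · i) hh
    simp only [Polynomial.coeff_map] at this
    rw [← this]
    exact (h.coeff i).2
  choose c hc using hc
  have hlift : minpoly (RatFunc 𝔽) a ∈ Polynomial.lifts (algebraMap 𝔽 (RatFunc 𝔽)) := by
    rw [Polynomial.lifts_iff_coeff_lifts]
    intro i
    refine ⟨c i, ?_⟩
    rw [← hg, Polynomial.coeff_map, ← hc, RatFunc.algebraMap_C]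
    rfl
  obtain ⟨f, hf, -, hmonic⟩ := Polynomial.lifts_and_degree_eq_and_monic hlift (minpoly.monic hF)
  refine ⟨f, hmonic, ?_⟩
  have h0 := minpoly.aeval (RatFunc 𝔽) a
  rw [← hf, Polynomial.aeval_def, Polynomial.eval₂_map] at h0
  have hC : algebraMap 𝔽 D = (algebraMap (RatFunc 𝔽) D).comp (algebraMap 𝔽 (RatFunc 𝔽)) :=
    RingHom.ext fun c ↦ algebraMap_const c
  rwa [hC]

variable (φ Λ) in
/-- The stabilizer of the class of `L` consists of the units that preserve `L`. If `γ L` is a multiple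
of `L`, then one of `γ` and `γ⁻¹` maps `L` into itself, and is thus an element of the ring
`latticeOrder φ Λ L`, which is closed under inverses. -/
theorem mem_stabilizer_mk_iff [Finite 𝔽] (hΛ : IsOrder 𝔽[X] (RatFunc 𝔽) D Λ) (γ : Λˣ) :
    embedding φ Λ γ • Vertex.mk L = Vertex.mk L ↔ ((γ : Λ) : D) ∈ latticeOrder φ Λ L := by
  have hinv : ((γ : Λ) : D)⁻¹ = ((γ⁻¹ : Λˣ) : Λ) :=
    inv_eq_of_mul_eq_one_right (congrArg Subtype.val γ.mul_inv)
  have hcomp (δ : Λˣ) (w : Fin 2 → CompletionAtInfty 𝔽) :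
      toEnd φ ((δ⁻¹ : Λˣ) : Λ) (toEnd φ (δ : Λ) w) = w := by
    rw [← Module.End.mul_apply, ← map_mul]
    have : (((δ⁻¹ : Λˣ) : Λ) : D) * (δ : Λ) = 1 := congrArg Subtype.val δ.inv_mul
    rw [this, map_one]
    rfl
  have hS (a : D) (ha : a ∈ latticeOrder φ Λ L) : IsIntegral 𝔽 a :=
    isIntegral_of_mem_latticeOrder hΛ ha
  constructor
  · intro h
    rw [smul_mk] at h
    obtain ⟨x, hx⟩ := Quotient.exact h
    replace hx : L.1 = x • image (embedding φ Λ γ) L.1 := hx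
    have h1 {w} (hw : w ∈ L.1) : (x : CompletionAtInfty 𝔽) • toEnd φ (γ : Λ) w ∈ L.1 := by
      refine hx.ge ?_
      exact Submodule.smul_mem_pointwise_smul _ x _ ⟨w, hw, rfl⟩
    have h2 {w} (hw : w ∈ L.1) : (x : CompletionAtInfty 𝔽)⁻¹ • toEnd φ ((γ⁻¹ : Λˣ) : Λ) w ∈ L.1 := by
      obtain ⟨_, ⟨u, hu, rfl⟩, rfl⟩ := hx.le hw
      change (x : CompletionAtInfty 𝔽)⁻¹ • toEnd φ ((γ⁻¹ : Λˣ) : Λ)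
        ((x : CompletionAtInfty 𝔽) • toEnd φ (γ : Λ) u) ∈ L.1
      rwa [map_smul, hcomp, inv_smul_smul₀ x.ne_zero]
    rcases (IntegersAtInfty 𝔽).mem_or_inv_mem (x : CompletionAtInfty 𝔽) with hxO | hxO
    -- Here `γ⁻¹ L = x L ⊆ L`.
    · have : (((γ⁻¹ : Λˣ) : Λ) : D) ∈ latticeOrder φ Λ L := by
        refine ⟨((γ⁻¹ : Λˣ) : Λ).2, fun w hw ↦ ?_⟩
        have := L.1.smul_mem ⟨_, hxO⟩ (h2 hw)
        convert this
        exact (smul_inv_smul₀ x.ne_zero _).symm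
      rw [← inv_inv ((γ : Λ) : D), hinv]
      exact Subalgebra.inv_mem_of_isIntegral hS this
    -- Here `γ L = x⁻¹ L ⊆ L`.
    · refine ⟨(γ : Λ).2, fun w hw ↦ ?_⟩
      have := L.1.smul_mem ⟨_, hxO⟩ (h1 hw)
      convert this
      exact (inv_smul_smul₀ x.ne_zero _).symm
  · intro h
    have h' : (((γ⁻¹ : Λˣ) : Λ) : D) ∈ latticeOrder φ Λ L :=
      hinv ▸ Subalgebra.inv_mem_of_isIntegral hS h
    rw [smul_mk]
    congr 1
    refine Subtype.ext (le_antisymm ?_ fun w hw ↦ ?_)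
    · rintro _ ⟨w, hw, rfl⟩
      exact h.2 w hw
    · refine ⟨_, h'.2 w hw, ?_⟩
      have := hcomp γ⁻¹ w
      rwa [inv_inv] at this

/-- The elements of `Λ` that preserve `L` act on the reduction of `L` modulo the maximal ideal, a space
of dimension two over the residue field. -/
theorem natCard_latticeOrder [Finite 𝔽] (hΛ : IsOrder 𝔽[X] (RatFunc 𝔽) D Λ) :
    Finite (latticeOrder φ Λ L) ∧ ∃ e, e ∣ 2 ∧ Nat.card (latticeOrder φ Λ L) = Nat.card 𝔽 ^ e := by
  have := L.2
  let k := IsLocalRing.ResidueField (IntegersAtInfty 𝔽)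
  let i : latticeOrder φ Λ L →+* L.1.endRing (K := CompletionAtInfty 𝔽) :=
    ((toEnd φ).comp (latticeOrder φ Λ L).val.toRingHom).codRestrict _ fun a ↦ a.2.2
  have hk : Nat.card k = Nat.card 𝔽 := natCard_residueField
  have : Module.Finite (IntegersAtInfty 𝔽) L.1 := Submodule.IsLattice.finite (CompletionAtInfty 𝔽) _
  have : Module.Free (IntegersAtInfty 𝔽) L.1 := Submodule.IsLattice.free (CompletionAtInfty 𝔽) _
  refine Subalgebra.natCard_eq_pow_of_action
    (fun a ha ↦ isIntegral_of_mem_latticeOrder hΛ ha)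
    (((Module.End.baseChangeHom (IntegersAtInfty 𝔽) k L.1).toRingHom.comp
      (L.1.endRingRestrict)).comp i) two_ne_zero ?_
  rw [Module.natCard_eq_pow_finrank (K := k), hk, Module.finrank_baseChange,
    Submodule.IsLattice.finrank_of_pi (CompletionAtInfty 𝔽), Fintype.card_fin]

/-- The elements of `Λ` that preserve the two lattices of an edge act on the quotient `L / L'`, a space
of dimension one over the residue field. -/
theorem natCard_latticeOrder_inf [Finite 𝔽] (hΛ : IsOrder 𝔽[X] (RatFunc 𝔽) D Λ)
    (e : (L.1 ⧸ L'.1.submoduleOf L.1) ≃ₗ[IntegersAtInfty 𝔽]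
      IsLocalRing.ResidueField (IntegersAtInfty 𝔽)) :
    Finite ↥(latticeOrder φ Λ L ⊓ latticeOrder φ Λ L') ∧
      Nat.card ↥(latticeOrder φ Λ L ⊓ latticeOrder φ Λ L') = Nat.card 𝔽 := by
  let N := L'.1.submoduleOf L.1
  let r (a : ↥(latticeOrder φ Λ L ⊓ latticeOrder φ Λ L')) : Module.End (IntegersAtInfty 𝔽) L.1 :=
    L.1.endRingRestrict ⟨toEnd φ a, a.2.1.2⟩
  have hr (a) : N ≤ N.comap (r a) := fun w hw ↦ a.2.2.2 w hw
  let θ : ↥(latticeOrder φ Λ L ⊓ latticeOrder φ Λ L') →+*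
      Module.End (IntegersAtInfty 𝔽) (L.1 ⧸ N) :=
    { toFun a := N.mapQ N (r a) (hr a)
      map_one' := Submodule.linearMap_qext _ (LinearMap.ext fun w ↦ congrArg N.mkQ (Subtype.ext
        (LinearMap.congr_fun (map_one (toEnd φ)) (w : Fin 2 → CompletionAtInfty 𝔽))))
      map_mul' a b := Submodule.linearMap_qext _ (LinearMap.ext fun w ↦ congrArg N.mkQ (Subtype.ext
        (LinearMap.congr_fun (map_mul (toEnd φ) (a : D) b) (w : Fin 2 → CompletionAtInfty 𝔽))))
      map_zero' := Submodule.linearMap_qext _ (LinearMap.ext fun w ↦ congrArg N.mkQ (Subtype.ext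
        (LinearMap.congr_fun (map_zero (toEnd φ)) (w : Fin 2 → CompletionAtInfty 𝔽))))
      map_add' a b := Submodule.linearMap_qext _ (LinearMap.ext fun w ↦ congrArg N.mkQ (Subtype.ext
        (LinearMap.congr_fun (map_add (toEnd φ) (a : D) b) (w : Fin 2 → CompletionAtInfty 𝔽)))) }
  have hW : Nat.card (L.1 ⧸ N) = Nat.card 𝔽 ^ 1 := by
    rw [pow_one, ← natCard_residueField (𝔽 := 𝔽)]
    exact Nat.card_congr e.toEquiv
  obtain ⟨hfin, n, hn, h⟩ := Subalgebra.natCard_eq_pow_of_action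
    (S := latticeOrder φ Λ L ⊓ latticeOrder φ Λ L')
    (fun a ha ↦ isIntegral_of_mem_latticeOrder (φ := φ) (L := L) hΛ ha.1) θ one_ne_zero hW
  rw [Nat.dvd_one.1 hn, pow_one] at h
  exact ⟨hfin, h⟩

end
end QuaternionUnits

open QuaternionUnits BruhatTits in
theorem proposition3p2
    (𝔽 𝔽₂ : Type*) [Field 𝔽] [Finite 𝔽] [DecidableEq (RatFunc 𝔽)]
    [Field 𝔽₂] (h𝔽₂ : Nat.card 𝔽₂ = Nat.card 𝔽 ^ 2)
    (D : Type*) [DivisionRing D] [Algebra (RatFunc 𝔽) D]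
    [Algebra.IsCentral (RatFunc 𝔽) D] (hD : Module.finrank (RatFunc 𝔽) D = 4)
    [Algebra 𝔽[X] D] [IsScalarTower 𝔽[X] (RatFunc 𝔽) D]
    (φ : (RatFunc.CompletionAtInfty 𝔽 ⊗[RatFunc 𝔽] D) ≃ₐ[RatFunc.CompletionAtInfty 𝔽]
      Matrix (Fin 2) (Fin 2) (RatFunc.CompletionAtInfty 𝔽))
    (Λ : Subalgebra 𝔽[X] D) (hΛ : QuaternionUnits.IsMaximalOrder 𝔽[X] (RatFunc 𝔽) D Λ) :
    (∀ v : BruhatTits.Vertex (IntegersAtInfty 𝔽) (RatFunc.CompletionAtInfty 𝔽)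
        (Fin 2 → RatFunc.CompletionAtInfty 𝔽),
      Nonempty ((MulAction.stabilizer _ v).comap (QuaternionUnits.embedding φ Λ) ≃* 𝔽ˣ) ∨
      Nonempty ((MulAction.stabilizer _ v).comap (QuaternionUnits.embedding φ Λ) ≃* 𝔽₂ˣ)) ∧
    (∀ y : BruhatTits.Edge (IntegersAtInfty 𝔽) (RatFunc.CompletionAtInfty 𝔽)
        (Fin 2 → RatFunc.CompletionAtInfty 𝔽),
      Nonempty ((MulAction.stabilizer _ y).comap (QuaternionUnits.embedding φ Λ) ≃* 𝔽ˣ)) := by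
  replace hΛ := hΛ.prop
  let : Algebra 𝔽 D := Algebra.compHom D (Polynomial.C : 𝔽 →+* 𝔽[X])
  have : IsScalarTower 𝔽 𝔽[X] D := .of_algebraMap_eq fun _ ↦ rfl
  constructor
  · rintro ⟨L⟩
    obtain ⟨hfin, e, he, h⟩ := natCard_latticeOrder (φ := φ) (L := L) hΛ
    obtain ⟨i⟩ := nonempty_mulEquiv_units (S := latticeOrder φ Λ L)
      (H := (MulAction.stabilizer _ (Vertex.mk L)).comap (embedding φ Λ)) (fun a ha ↦ ha.1)
      (fun a ↦ Subalgebra.inv_mem_of_isIntegral fun a ha ↦ isIntegral_of_mem_latticeOrder hΛ ha)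
      (mem_stabilizer_mk_iff φ Λ hΛ)
    rcases (Nat.dvd_prime Nat.prime_two).1 he with rfl | rfl
    · left
      rw [pow_one] at h
      obtain ⟨j⟩ := nonempty_units_mulEquiv_of_natCard_eq h
      exact ⟨i.trans j⟩
    · right
      rw [← h𝔽₂] at h
      obtain ⟨j⟩ := nonempty_units_mulEquiv_of_natCard_eq h
      exact ⟨i.trans j⟩
  · intro y
    -- The adjacency relation is symmetrized, so that either end of the edge may be the larger lattice.
    have key (L L') (hy : y.fst = Vertex.mk L ∧ y.snd = Vertex.mk L' ∨
        y.fst = Vertex.mk L' ∧ y.snd = Vertex.mk L)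
        (e : (L.1 ⧸ L'.1.submoduleOf L.1) ≃ₗ[IntegersAtInfty 𝔽]
          IsLocalRing.ResidueField (IntegersAtInfty 𝔽)) :
        Nonempty ((MulAction.stabilizer _ y).comap (embedding φ Λ) ≃* 𝔽ˣ) := by
      obtain ⟨hfin, h⟩ := natCard_latticeOrder_inf (φ := φ) hΛ e
      obtain ⟨i⟩ := nonempty_mulEquiv_units (S := latticeOrder φ Λ L ⊓ latticeOrder φ Λ L')
        (H := (MulAction.stabilizer _ y).comap (embedding φ Λ)) (fun a ha ↦ ha.1.1)
        (fun a ↦ Subalgebra.inv_mem_of_isIntegral (S := latticeOrder φ Λ L ⊓ latticeOrder φ Λ L')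
          fun a ha ↦ isIntegral_of_mem_latticeOrder (φ := φ) (L := L) hΛ ha.1) (fun γ ↦ by
          rw [Subgroup.mem_comap, MulAction.mem_stabilizer_iff, SimpleGraph.Dart.ext_iff,
            Prod.ext_iff, Algebra.mem_inf, ← mem_stabilizer_mk_iff φ Λ hΛ,
            ← mem_stabilizer_mk_iff φ Λ hΛ]
          change embedding φ Λ γ • y.fst = y.fst ∧ embedding φ Λ γ • y.snd = y.snd ↔ _
          rcases hy with ⟨h1, h2⟩ | ⟨h1, h2⟩
          · rw [h1, h2]
          · rw [h1, h2, and_comm])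
      obtain ⟨j⟩ := nonempty_units_mulEquiv_of_natCard_eq h
      exact ⟨i.trans j⟩
    have hadj := y.adj
    rcases ((SimpleGraph.fromRel_adj _ _ _).1 hadj).2 with ⟨L, L', h1, h2, -, ⟨e⟩⟩ | ⟨L, L', h1, h2, -, ⟨e⟩⟩
    · exact key L L' (.inl ⟨h1.symm, h2.symm⟩) e
    · exact key L L' (.inr ⟨h2.symm, h1.symm⟩) e
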